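/- Let $(\mathcal M,g)$ be a spacetime of dimension $n\ge 2$ (in particular $n=4$): $\mathcal M$ is a connected Hausdorff $C^\infty$ $n$-manifold without boundary, $g$ is a $C^\infty$ Lorentzian metric of signature $(+,-,\dots,-)$, and a time-orientation is fixed. A vector $v$ is timelike if $g(v,v)>0$, and null if $g(v,v)=0$ and $v\neq0$. A time-orientation is a choice, at each point $x$, of one of the two timecones of $T_x\mathcal M$ (its elements are the future-pointing timelike vectors), such that near each point there is a smooth vector field with values in the chosen timecones. A null vector is future-pointing if it is a limit of future-pointing timelike vectors in the same tangent space. A trip from $x$ to $y$ is a curve $\gamma:[a,b]\to\mathcal M$, $a<b$, with $\gamma(a)=x$, $\gamma(b)=y$, for which there is a subdivision $a=t_0<\dots<t_k=b$, $k\ge1$, such that $\gamma$ restricted to each $[t_i,t_{i+1}]$ is the restriction of a geodesic of the Levi-Civita connection of $g$, defined on an open interval containing $[t_i,t_{i+1}]$, whose tangent vectors are future-pointing timelike on $[t_i,t_{i+1}]$. A causal trip is defined in the same way, with future-pointing timelike or null tangent vectors, and with constant (degenerate) pieces also allowed. Write $x\ll y$ if there is a trip from $x$ to $y$, and $x\prec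 y$ if there is a causal trip from $x$ to $y$. Put $I^+(x)=\{y: x\ll y\}$, $J^+(x)=\{y: x\prec y\}$, and, for $\mathcal S\subset\mathcal M$, $I^+(\mathcal S)=\bigcup_{x\in\mathcal S}I^+(x)$ and $J^+(\mathcal S)=\bigcup_{x\in\mathcal S}J^+(x)$. Then for every point $x\in\mathcal M$ and every subset $\mathcal S\subset\mathcal M$: 1. $I^+(x)$ is open in $\mathcal M$. 2. $I^+(\mathcal S)$ is open in $\mathcal M$. 3. $I^+(\mathcal S)=I^+(\overline{\mathcal S})$. 4. $I^+(\mathcal S)=I^+(I^+(\mathcal S))\subseteq J^+(\mathcal S)=J^+(J^+(\mathcal S))$. -/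

import Mathlib

open Set Filter Topology
open scoped Manifold ContDiff Bundle

noncomputable section

namespace Spacetime

section

variable {n : ℕ} {M : Type*} [TopologicalSpace M]
  [ChartedSpace (EuclideanSpace ℝ (Fin n)) M] [IsManifold (𝓡 n) ∞ M]

variable (n M) in
/-- A smooth Lorentz metric on an `n`-dimensional smooth manifold `M`: a smooth symmetric
`(0,2)`-tensor field which, at each point, has the matrix `diag(1, -1, …, -1)` relative to some
basis of the tangent space (in particular it is nondegenerate). -/
structure LorentzMetric where
  /-- The scalar product on the tangent space at `x`. -/
  form (x : M) : TangentSpace (𝓡 n) x →L[ℝ] TangentSpace (𝓡 n) x →L[ℝ] ℝ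
  symm (x : M) (v w : TangentSpace (𝓡 n) x) : form x v w = form x w v
  lorentzian (x : M) : ∃ b : Module.Basis (Fin n) ℝ (TangentSpace (𝓡 n) x), ∀ i j : Fin n,
    form x (b i) (b j) = if i = j then (if (i : ℕ) = 0 then 1 else -1) else 0
  contMDiff : ContMDiff (𝓡 n)
    ((𝓡 n).prod 𝓘(ℝ, EuclideanSpace ℝ (Fin n) →L[ℝ] EuclideanSpace ℝ (Fin n) →L[ℝ] ℝ)) ∞
    (fun x ↦ Bundle.TotalSpace.mk'
      (EuclideanSpace ℝ (Fin n) →L[ℝ] EuclideanSpace ℝ (Fin n) →L[ℝ] ℝ)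
      (E := fun x : M ↦ TangentSpace (𝓡 n) x →L[ℝ] TangentSpace (𝓡 n) x →L[ℝ] ℝ) x (form x))

/-! ### Vector character and time orientation -/

/-- `v` is timelike if `g(v,v) > 0`. -/
def IsTimelike (g : LorentzMetric n M) {x : M} (v : TangentSpace (𝓡 n) x) : Prop :=
  0 < g.form x v v

/-- `v` is null if `g(v,v) = 0` and `v ≠ 0`. -/
def IsNull (g : LorentzMetric n M) {x : M} (v : TangentSpace (𝓡 n) x) : Prop :=
  g.form x v v = 0 ∧ v ≠ 0

/-- The timecone `{v timelike : g(u,v) > 0}` of a vector `u`. -/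
def timecone (g : LorentzMetric n M) {x : M} (u : TangentSpace (𝓡 n) x) :
    Set (TangentSpace (𝓡 n) x) :=
  {v | IsTimelike g v ∧ 0 < g.form x u v}

/-- A time orientation: a choice, at each point, of one of the two timecones (called the future
timecone), which near each point contains the values of a smooth vector field. -/
structure TimeOrientation (g : LorentzMetric n M) where
  /-- The set of future-pointing timelike vectors at `x`. -/
  future (x : M) : Set (TangentSpace (𝓡 n) x)
  isTimecone (x : M) : ∃ u : TangentSpace (𝓡 n) x, IsTimelike g u ∧ future x = timecone g u
  smooth (x : M) : ∃ U : Set M, IsOpen U ∧ x ∈ U ∧ ∃ X : ∀ y : M, TangentSpace (𝓡 n) y,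
    ContMDiffOn (𝓡 n) (𝓡 n).tangent ∞ (fun y ↦ (⟨y, X y⟩ : TangentBundle (𝓡 n) M)) U ∧
    ∀ y ∈ U, X y ∈ future y

/-- Future-pointing causal vectors: future-pointing timelike vectors, together with the null
vectors that are limits of future-pointing timelike vectors. -/
def IsFutureCausal {g : LorentzMetric n M} (τ : TimeOrientation g) {x : M}
    (v : TangentSpace (𝓡 n) x) : Prop :=
  v ∈ τ.future x ∨ (IsNull g v ∧ v ∈ closure (τ.future x))

/-! ### Geodesics -/

/-- The coordinate vector `∂_a` of the chart `e`, at the point with coordinates `p`. -/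
def coordVector (e : OpenPartialHomeomorph M (EuclideanSpace ℝ (Fin n)))
    (p : EuclideanSpace ℝ (Fin n)) (a : Fin n) : TangentSpace (𝓡 n) (e.symm p) :=
  mfderiv (𝓡 n) (𝓡 n) e.symm p (EuclideanSpace.single a (1 : ℝ))

/-- The matrix `g_{ab}` of the metric in the chart `e`, as a function of the coordinates. -/
def metricMatrix (g : LorentzMetric n M) (e : OpenPartialHomeomorph M (EuclideanSpace ℝ (Fin n)))
    (p : EuclideanSpace ℝ (Fin n)) : Matrix (Fin n) (Fin n) ℝ :=
  Matrix.of fun a b ↦ g.form (e.symm p) (coordVector e p a) (coordVector e p b)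

/-- The partial derivative `∂_a f`. -/
def partialDeriv (a : Fin n) (f : EuclideanSpace ℝ (Fin n) → ℝ)
    (p : EuclideanSpace ℝ (Fin n)) : ℝ :=
  fderiv ℝ f p (EuclideanSpace.single a (1 : ℝ))

/-- The Christoffel symbols
`Γ^c_{ab} = (1/2) g^{cd} (∂_a g_{bd} + ∂_b g_{ad} - ∂_d g_{ab})` of the Levi-Civita connection
in the chart `e`, as functions of the coordinates. -/
def christoffel (g : LorentzMetric n M) (e : OpenPartialHomeomorph M (EuclideanSpace ℝ (Fin n)))
    (c a b : Fin n) (p : EuclideanSpace ℝ (Fin n)) : ℝ :=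
  (1 / 2 : ℝ) * ∑ d : Fin n, (metricMatrix g e p)⁻¹ c d *
    (partialDeriv a (fun q ↦ metricMatrix g e q b d) p
      + partialDeriv b (fun q ↦ metricMatrix g e q a d) p
      - partialDeriv d (fun q ↦ metricMatrix g e q a b) p)

/-- The geodesic equations `ẍ^c + Γ^c_{ab} ẋ^a ẋ^b = 0` at parameter `t` for the
coordinate expression `x = e ∘ γ` of the path `γ` in the chart `e`. -/
def GeodesicEqAt (g : LorentzMetric n M)
    (e : OpenPartialHomeomorph M (EuclideanSpace ℝ (Fin n))) (γ : ℝ → M) (t : ℝ) : Prop :=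
  ∀ c : Fin n, (deriv (deriv (fun s ↦ e (γ s))) t) c
    + ∑ a : Fin n, ∑ b : Fin n, christoffel g e c a b (e (γ t))
        * (deriv (fun s ↦ e (γ s)) t) a * (deriv (fun s ↦ e (γ s)) t) b = 0

/-- `γ` is a geodesic (possibly degenerate) on the open set `J` of parameters: it is smooth on `J`
and, near each parameter in `J`, satisfies the geodesic equations in a smooth chart around the
corresponding point. The equations are covariant under changes of charts, so that it is
immaterial which chart is used. -/
structure IsGeodesicOn (g : LorentzMetric n M) (γ : ℝ → M) (J : Set ℝ) : Prop where
  contMDiffOn : ContMDiffOn 𝓘(ℝ, ℝ) (𝓡 n) ∞ γ J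
  geodesicEq : ∀ t₀ ∈ J, ∃ e ∈ IsManifold.maximalAtlas (𝓡 n) ∞ M,
    γ t₀ ∈ e.source ∧ ∀ᶠ t in 𝓝 t₀, GeodesicEqAt g e γ t

variable (n) in
/-- The tangent vector of the path `γ` at the parameter `t`. -/
def velocity (γ : ℝ → M) (t : ℝ) : TangentSpace (𝓡 n) (γ t) :=
  mfderiv 𝓘(ℝ, ℝ) (𝓡 n) γ t (1 : ℝ)

/-! ### Trips, chronology and causality -/

/-- On `[s, t]` the path `γ` is a future-pointing timelike geodesic segment: it is the restriction
of a geodesic defined on a larger open interval, with future-pointing timelike tangent vectors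
along `[s, t]`. -/
def IsTimelikeGeodesicSegment {g : LorentzMetric n M} (τ : TimeOrientation g)
    (γ : ℝ → M) (s t : ℝ) : Prop :=
  ∃ (σ : ℝ → M) (l r : ℝ), l < s ∧ t < r ∧ IsGeodesicOn g σ (Ioo l r) ∧
    (∀ u ∈ Icc s t, velocity n σ u ∈ τ.future (σ u)) ∧ EqOn γ σ (Icc s t)

/-- On `[s, t]` the path `γ` is a future-pointing causal geodesic segment, possibly degenerate
(that is, constant). -/
def IsCausalGeodesicSegment {g : LorentzMetric n M} (τ : TimeOrientation g)
    (γ : ℝ → M) (s t : ℝ) : Prop :=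
  (∃ (σ : ℝ → M) (l r : ℝ), l < s ∧ t < r ∧ IsGeodesicOn g σ (Ioo l r) ∧
    (∀ u ∈ Icc s t, IsFutureCausal τ (velocity n σ u)) ∧ EqOn γ σ (Icc s t)) ∨
  (∀ u ∈ Icc s t, γ u = γ s)

/-- `[a, b]` has a subdivision `a = t₀ < t₁ < ⋯ < t_k = b`, with `k ≥ 1`, such that `P` holds for
each of the intervals `[t_i, t_{i+1}]`. -/
def Piecewise (P : ℝ → ℝ → Prop) (a b : ℝ) : Prop :=
  ∃ (k : ℕ) (t : ℕ → ℝ), 0 < k ∧ t 0 = a ∧ t k = b ∧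
    ∀ i < k, t i < t (i + 1) ∧ P (t i) (t (i + 1))

/-- `γ : [a, b] → M` is a trip: piecewise a future-pointing timelike geodesic. -/
def IsTrip {g : LorentzMetric n M} (τ : TimeOrientation g) (γ : ℝ → M) (a b : ℝ) : Prop :=
  Piecewise (IsTimelikeGeodesicSegment τ γ) a b

/-- `γ : [a, b] → M` is a causal trip: piecewise a future-pointing causal geodesic, possibly
degenerate. -/
def IsCausalTrip {g : LorentzMetric n M} (τ : TimeOrientation g) (γ : ℝ → M) (a b : ℝ) : Prop :=
  Piecewise (IsCausalGeodesicSegment τ γ) a b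

/-- `x ≪ y`: there is a trip from `x` to `y`. -/
def ChronPrecedes {g : LorentzMetric n M} (τ : TimeOrientation g) (x y : M) : Prop :=
  ∃ (γ : ℝ → M) (a b : ℝ), IsTrip τ γ a b ∧ γ a = x ∧ γ b = y

/-- `x ≺ y`: there is a causal trip from `x` to `y`. -/
def CausallyPrecedes {g : LorentzMetric n M} (τ : TimeOrientation g) (x y : M) : Prop :=
  ∃ (γ : ℝ → M) (a b : ℝ), IsCausalTrip τ γ a b ∧ γ a = x ∧ γ b = y

/-- The chronological future `I⁺(x)` of a point. -/
def chronFuture {g : LorentzMetric n M} (τ : TimeOrientation g) (x : M) : Set M :=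
  {y | ChronPrecedes τ x y}

/-- The causal future `J⁺(x)` of a point. -/
def causalFuture {g : LorentzMetric n M} (τ : TimeOrientation g) (x : M) : Set M :=
  {y | CausallyPrecedes τ x y}

/-- The chronological future `I⁺(S)` of a set. -/
def chronFutureSet {g : LorentzMetric n M} (τ : TimeOrientation g) (S : Set M) : Set M :=
  ⋃ x ∈ S, chronFuture τ x

/-- The causal future `J⁺(S)` of a set. -/
def causalFutureSet {g : LorentzMetric n M} (τ : TimeOrientation g) (S : Set M) : Set M :=
  ⋃ x ∈ S, causalFuture τ x

end

end Spacetime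

end

/-! Everything rests on one local fact: if a geodesic is future-pointing timelike at `t₀`, then for
small `h ≠ 0` every point near its position at `t₀` is joined to its position at `t₀ + h` by a
future-pointing timelike geodesic (`IsGeodesicOn.exists_joining`).

Instead of normal neighbourhoods, the proof shoots geodesics in a chart. Fix the position `p` at
time `t₀ + h`, vary the velocity there, and follow the solution for time `-h`. Since the flow is
Lipschitz in its initial value, the resulting map of velocities is multiplication by `-h` up to a
relative error of at most `|h| / 2`. A quantitative inverse function theorem makes its image a
neighbourhood of the original position (`exists_solution_joining`). Being future-pointing timelike
is an open condition on position and velocity, so the new geodesics inherit it.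

Negative `h` redirects the last segment of a trip, which makes `I⁺(x)` open and inserts an
intermediate point, so that `I⁺(S) ⊆ I⁺(I⁺(S))`. Positive `h` redirects the first segment, which
makes the past of a point open and hence allows `closure S` to be replaced by `S`. The remaining
assertions are transitivity and reflexivity, obtained by reading trips as chains of segments. -/

noncomputable section

namespace Spacetime

/-! ### Shooting for second-order differential equations -/

section ODE

open Metric
open scoped NNReal

/-- A `C¹` vector field has a local flow which is Lipschitz in the initial value, uniformly in
time, and stays in a given neighbourhood. -/
theorem exists_local_flow {V : Type*} [NormedAddCommGroup V] [NormedSpace ℝ V] [CompleteSpace V]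
    {f : V → V} {x₀ : V} (hf : ContDiffAt ℝ 1 f x₀) {W : Set V} (hW : W ∈ 𝓝 x₀) :
    ∃ r > (0 : ℝ), ∃ ε > (0 : ℝ), ∃ K : ℝ≥0, ∃ α : V → ℝ → V,
      (∀ x ∈ closedBall x₀ r, α x 0 = x ∧ ∀ t ∈ Ioo (-ε) ε,
        HasDerivAt (α x) (f (α x t)) t ∧ α x t ∈ W) ∧
      ∀ t ∈ Ioo (-ε) ε, LipschitzOnWith K (α · t) (closedBall x₀ r) := by
  obtain ⟨ε, hε, a, r, L, K, hr, hpl⟩ := IsPicardLindelof.of_contDiffAt_one hf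
  obtain ⟨α, hα, K', hK'⟩ :=
    (hpl 0).exists_forall_mem_closedBall_eq_hasDerivWithinAt_lipschitzOnWith
  have hr' : (0 : ℝ) < r := hr
  -- Joint continuity is what allows time and initial value to be restricted together so that the
  -- flow stays in `W`.
  have hcont : ContinuousOn (Function.uncurry α) (closedBall x₀ r ×ˢ Icc (0 - ε) (0 + ε)) :=
    continuousOn_prod_of_continuousOn_lipschitzOnWith _ K'
      (fun x hx ↦ HasDerivWithinAt.continuousOn (hα x hx).2) hK'
  have hnhds : closedBall x₀ (r : ℝ) ×ˢ Icc (0 - ε) (0 + ε) ∈ 𝓝 (x₀, (0 : ℝ)) :=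
    prod_mem_nhds (closedBall_mem_nhds _ hr') (Icc_mem_nhds (by linarith) (by linarith))
  have hat : ContinuousAt (Function.uncurry α) (x₀, 0) := hcont.continuousAt hnhds
  have hx₀ : Function.uncurry α (x₀, 0) = x₀ := (hα x₀ (mem_closedBall_self hr'.le)).1
  have hWn : Function.uncurry α ⁻¹' W ∈ 𝓝 (x₀, (0 : ℝ)) := hat (by rwa [hx₀])
  obtain ⟨ρ, hρ, hball⟩ := nhds_basis_closedBall.mem_iff.1 hWn
  refine ⟨min r ρ, lt_min hr' hρ, min ε ρ, lt_min hε hρ, K', α, fun x hx ↦ ?_, fun t ht ↦ ?_⟩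
  · have hx' : x ∈ closedBall x₀ r := closedBall_subset_closedBall (min_le_left _ _) hx
    refine ⟨(hα x hx').1, fun t ht ↦ ?_⟩
    have h1 := min_le_left ε ρ
    have h2 := min_le_right ε ρ
    refine ⟨((hα x hx').2 t ⟨by linarith [ht.1], by linarith [ht.2]⟩).hasDerivAt
      (Icc_mem_nhds (by linarith [ht.1]) (by linarith [ht.2])), ?_⟩
    have : (x, t) ∈ closedBall (x₀, (0 : ℝ)) ρ := by
      rw [← closedBall_prod_same]
      refine ⟨closedBall_subset_closedBall (min_le_right _ _) hx, ?_⟩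
      rw [Real.closedBall_eq_Icc]
      exact ⟨by linarith [ht.1], by linarith [ht.2]⟩
    exact hball this
  · have h1 := min_le_left ε ρ
    exact (hK' t ⟨by linarith [ht.1], by linarith [ht.2]⟩).mono
      (closedBall_subset_closedBall (min_le_left _ _))

variable {E : Type*} [NormedAddCommGroup E] [NormedSpace ℝ E]

theorem hasDerivAt_fst_comp {z : ℝ → E × E} {z' : E × E} {t : ℝ} (h : HasDerivAt z z' t) :
    HasDerivAt (fun s ↦ (z s).1) z'.1 t :=
  (ContinuousLinearMap.fst ℝ E E).hasFDerivAt.comp_hasDerivAt t h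

theorem hasDerivAt_snd_comp {z : ℝ → E × E} {z' : E × E} {t : ℝ} (h : HasDerivAt z z' t) :
    HasDerivAt (fun s ↦ (z s).2) z'.2 t :=
  (ContinuousLinearMap.snd ℝ E E).hasFDerivAt.comp_hasDerivAt t h

/-- For two solutions of a second-order equation which start at the same point and whose distance
is bounded by that of their initial velocities, the positions at time `τ` differ by approximately
`τ` times the difference of the initial velocities. -/
theorem norm_position_sub_le {A : E × E → E} {K L : ℝ≥0} {S : Set (E × E)}
    (hA : LipschitzOnWith K (fun z : E × E ↦ (z.2, A z)) S) {z₁ z₂ : ℝ → E × E} {τ : ℝ}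
    (h₁ : ∀ t ∈ uIcc 0 τ, HasDerivAt z₁ ((z₁ t).2, A (z₁ t)) t ∧ z₁ t ∈ S)
    (h₂ : ∀ t ∈ uIcc 0 τ, HasDerivAt z₂ ((z₂ t).2, A (z₂ t)) t ∧ z₂ t ∈ S)
    (hp : (z₁ 0).1 = (z₂ 0).1)
    (hd : ∀ t ∈ uIcc 0 τ, ‖z₁ t - z₂ t‖ ≤ L * ‖(z₁ 0).2 - (z₂ 0).2‖) :
    ‖(z₁ τ).1 - (z₂ τ).1 - τ • ((z₁ 0).2 - (z₂ 0).2)‖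
      ≤ K * L * |τ| * |τ| * ‖(z₁ 0).2 - (z₂ 0).2‖ := by
  set Δ := (z₁ 0).2 - (z₂ 0).2 with hΔ
  have hconv : Convex ℝ (uIcc 0 τ) := convex_uIcc 0 τ
  have habs : ∀ t ∈ uIcc 0 τ, |t| ≤ |τ| := fun t ht ↦ by
    simpa using abs_sub_left_of_mem_uIcc ht
  -- The mean value inequality is used twice, for the velocities and then for the positions; each
  -- use costs a factor `|τ|`.
  have hvel : ∀ t ∈ uIcc 0 τ, ‖(z₁ t).2 - (z₂ t).2 - Δ‖ ≤ K * L * |τ| * ‖Δ‖ := by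
    intro t ht
    have hderiv : ∀ s ∈ uIcc 0 τ, HasDerivWithinAt (fun s ↦ (z₁ s).2 - (z₂ s).2)
        (A (z₁ s) - A (z₂ s)) (uIcc 0 τ) s := fun s hs ↦
      ((hasDerivAt_snd_comp (h₁ s hs).1).sub (hasDerivAt_snd_comp (h₂ s hs).1)).hasDerivWithinAt
    have hbound : ∀ s ∈ uIcc 0 τ, ‖A (z₁ s) - A (z₂ s)‖ ≤ K * (L * ‖Δ‖) := fun s hs ↦ by
      have h := hA.norm_sub_le (h₁ s hs).2 (h₂ s hs).2
      calc ‖A (z₁ s) - A (z₂ s)‖ ≤ K * ‖z₁ s - z₂ s‖ := (norm_snd_le _).trans h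
        _ ≤ K * (L * ‖Δ‖) := by gcongr; exact hd s hs
    have h := hconv.norm_image_sub_le_of_norm_hasDerivWithin_le hderiv hbound left_mem_uIcc ht
    calc ‖(z₁ t).2 - (z₂ t).2 - Δ‖ ≤ K * (L * ‖Δ‖) * ‖t - 0‖ := h
      _ ≤ K * (L * ‖Δ‖) * |τ| := by
        gcongr
        simpa using habs t ht
      _ = K * L * |τ| * ‖Δ‖ := by ring
  have hderiv : ∀ s ∈ uIcc 0 τ, HasDerivWithinAt (fun s ↦ (z₁ s).1 - (z₂ s).1 - s • Δ)
      ((z₁ s).2 - (z₂ s).2 - Δ) (uIcc 0 τ) s := fun s hs ↦ by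
    have := ((hasDerivAt_fst_comp (h₁ s hs).1).sub (hasDerivAt_fst_comp (h₂ s hs).1)).sub
      ((hasDerivAt_id s).smul_const Δ)
    rw [one_smul] at this
    exact this.hasDerivWithinAt
  have h := hconv.norm_image_sub_le_of_norm_hasDerivWithin_le hderiv hvel left_mem_uIcc
    right_mem_uIcc
  calc ‖(z₁ τ).1 - (z₂ τ).1 - τ • Δ‖ ≤ K * L * |τ| * ‖Δ‖ * ‖τ - 0‖ := by simpa [hp] using h
    _ = K * L * |τ| * |τ| * ‖Δ‖ := by rw [sub_zero, Real.norm_eq_abs]; ring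

/-- If `G` is approximated by multiplication by `τ ≠ 0` near `v₀` up to an error of relative size
at most `|τ| / 2`, then it maps neighbourhoods of `v₀` to neighbourhoods of `G v₀`. -/
theorem image_mem_nhds_of_norm_sub_smul_le [CompleteSpace E] {G : E → E} {τ : ℝ} (hτ : τ ≠ 0)
    {s : Set E} {v₀ : E} (hs : s ∈ 𝓝 v₀)
    (hG : ∀ v ∈ s, ∀ w ∈ s, ‖G v - G w - τ • (v - w)‖ ≤ |τ| / 2 * ‖v - w‖) :
    G '' s ∈ 𝓝 (G v₀) := by
  -- After division by `τ`, `G` is within `1/2` of the identity, and `1/2` is less than the inverse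
  -- norm of the identity unless the space is trivial.
  have happ : ApproximatesLinearOn (fun v ↦ τ⁻¹ • G v)
      ((ContinuousLinearEquiv.refl ℝ E : E ≃L[ℝ] E) : E →L[ℝ] E) s (1 / 2) := by
    intro v hv w hw
    have : τ⁻¹ • G v - τ⁻¹ • G w - (v - w) = τ⁻¹ • (G v - G w - τ • (v - w)) := by
      rw [smul_sub, smul_sub, smul_smul, inv_mul_cancel₀ hτ, one_smul]
    simp only [ContinuousLinearEquiv.coe_refl, ContinuousLinearMap.coe_id', id_eq]
    rw [this, norm_smul, norm_inv, Real.norm_eq_abs]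
    have hpos : 0 < |τ| := abs_pos.2 hτ
    rw [inv_mul_le_iff₀ hpos]
    refine (hG v hv w hw).trans (le_of_eq ?_)
    push_cast
    ring
  have h := happ.image_mem_nhds (ContinuousLinearEquiv.refl ℝ E).toNonlinearRightInverse hs (by
    rcases subsingleton_or_nontrivial E with hE | hE
    · exact Or.inl hE
    · right
      change (1 / 2 : ℝ≥0) < ‖ContinuousLinearMap.id ℝ E‖₊⁻¹
      rw [ContinuousLinearMap.nnnorm_id, inv_one]
      exact NNReal.half_lt_self one_ne_zero)
  have hcomp := ((Homeomorph.smulOfNeZero τ hτ).isOpenMap).image_mem_nhds h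
  rw [image_image] at hcomp
  simpa [smul_smul, mul_inv_cancel₀ hτ] using hcomp

/-- Let `z` be a solution of a second-order equation near `t₀`. If `h ≠ 0` is small then each point
near the position of `z` at time `t₀` is the position at time `t₀` of a solution which has at time
`t₀ + h` the same position as `z`, and which stays near `z t₀`. -/
theorem exists_solution_joining [CompleteSpace E] {A : E × E → E} {z : ℝ → E × E} {t₀ : ℝ}
    {W : Set (E × E)} (hA : ContDiffAt ℝ 1 A (z t₀))
    (hz : ∀ᶠ t in 𝓝 t₀, HasDerivAt z ((z t).2, A (z t)) t) (hW : W ∈ 𝓝 (z t₀)) :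
    ∃ δ > (0 : ℝ), ∀ h : ℝ, h ≠ 0 → |h| < δ → ∀ᶠ y in 𝓝 (z t₀).1, ∃ w : ℝ → E × E,
      (∀ t ∈ Ioo (t₀ - δ) (t₀ + δ), HasDerivAt w ((w t).2, A (w t)) t ∧ w t ∈ W) ∧
      (w (t₀ + h)).1 = (z (t₀ + h)).1 ∧ (w t₀).1 = y := by
  have hF : ContDiffAt ℝ 1 (fun z : E × E ↦ (z.2, A z)) (z t₀) := contDiffAt_snd.prodMk hA
  obtain ⟨K, S, hS, hK⟩ := hF.exists_lipschitzOnWith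
  obtain ⟨r, hr, ε, hε, L, α, hα, hL⟩ := exists_local_flow hF (inter_mem hW hS)
  have hzc : ContinuousAt z t₀ := hz.self_of_nhds.continuousAt
  have hzr : ∀ᶠ t in 𝓝 t₀, z t ∈ ball (z t₀) r ∩ S :=
    hzc (inter_mem (ball_mem_nhds _ hr) hS)
  obtain ⟨δ₁, hδ₁, hball⟩ := eventually_nhds_iff_ball.1 (hz.and hzr)
  rw [Real.ball_eq_Ioo] at hball
  -- The bound `δ₁` keeps `z` a solution inside `S`. The half of `ε` is needed because flow time is
  -- counted from `t₀ + h` and so reaches `2δ`. The last bound gives `K * L * |h| ≤ 1/2`, the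
  -- relative error allowed in the shooting map.
  set δ := min (min δ₁ (ε / 2)) (1 / (2 * (K * L + 1))) with hδ
  have hδ1 : δ ≤ δ₁ := (min_le_left _ _).trans (min_le_left _ _)
  have hδ2 : δ ≤ ε / 2 := (min_le_left _ _).trans (min_le_right _ _)
  have hδ3 : δ ≤ 1 / (2 * (K * L + 1)) := min_le_right _ _
  have hδ0 : 0 < δ := by
    refine lt_min (lt_min hδ₁ (by linarith)) (by positivity)
  refine ⟨δ, hδ0, fun h h0 hh ↦ ?_⟩
  have hh' := abs_lt.1 hh
  have hmem : t₀ + h ∈ Ioo (t₀ - δ₁) (t₀ + δ₁) := ⟨by linarith, by linarith⟩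
  obtain ⟨-, hzball, -⟩ := hball _ hmem
  set p := (z (t₀ + h)).1 with hp
  have hzball' : p ∈ ball (z t₀).1 r ∧ (z (t₀ + h)).2 ∈ ball (z t₀).2 r := by
    rwa [← Prod.mk.eta (p := z t₀), ← ball_prod_same] at hzball
  have hin : ∀ v ∈ closedBall (z t₀).2 r, (p, v) ∈ closedBall (z t₀) r := fun v hv ↦ by
    rw [← Prod.mk.eta (p := z t₀), ← closedBall_prod_same]
    exact ⟨ball_subset_closedBall hzball'.1, hv⟩
  have hsub : ∀ t ∈ uIcc 0 (-h), t ∈ Ioo (-ε) ε := fun t ht ↦ by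
    have h1 : |t| ≤ |h| := by simpa using abs_sub_left_of_mem_uIcc ht
    exact abs_lt.1 (by linarith)
  have himage := image_mem_nhds_of_norm_sub_smul_le (G := fun v ↦ (α (p, v) (-h)).1)
    (neg_ne_zero.2 h0) (s := closedBall (z t₀).2 r) (v₀ := (z (t₀ + h)).2)
    (mem_of_superset (isOpen_ball.mem_nhds hzball'.2) ball_subset_closedBall) (by
      intro v hv w hw
      have hv' := hα _ (hin v hv)
      have hw' := hα _ (hin w hw)
      have key := norm_position_sub_le hK (L := L) (τ := -h) (z₁ := α (p, v)) (z₂ := α (p, w))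
        (fun t ht ↦ ⟨(hv'.2 t (hsub t ht)).1, (hv'.2 t (hsub t ht)).2.2⟩)
        (fun t ht ↦ ⟨(hw'.2 t (hsub t ht)).1, (hw'.2 t (hsub t ht)).2.2⟩)
        (by rw [hv'.1, hw'.1]) (by
          intro t ht
          rw [hv'.1, hw'.1]
          have := (hL t (hsub t ht)).norm_sub_le (hin v hv) (hin w hw)
          simpa [Prod.norm_def] using this)
      rw [hv'.1, hw'.1] at key
      refine key.trans ?_
      have h1 : (K : ℝ) * L * |-h| ≤ 1 / 2 := by
        rw [abs_neg]
        have h2 : |h| ≤ 1 / (2 * (K * L + 1)) := hh.le.trans hδ3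
        rw [le_div_iff₀ (by positivity)] at h2
        nlinarith [abs_nonneg h]
      calc (K : ℝ) * L * |-h| * |-h| * ‖v - w‖ ≤ 1 / 2 * |-h| * ‖v - w‖ := by gcongr
        _ = |-h| / 2 * ‖v - w‖ := by ring)
  have hshift : ∀ v ∈ closedBall (z t₀).2 r, ∀ t ∈ Ioo (t₀ - δ) (t₀ + δ),
      HasDerivAt (fun t ↦ α (p, v) (t - (t₀ + h)))
        ((α (p, v) (t - (t₀ + h))).2, A (α (p, v) (t - (t₀ + h)))) t ∧
      α (p, v) (t - (t₀ + h)) ∈ W ∩ S := fun v hv t ht ↦ by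
    have := (hα _ (hin v hv)).2 (t - (t₀ + h)) ⟨by linarith [ht.1], by linarith [ht.2]⟩
    exact ⟨this.1.comp_sub_const t (t₀ + h), this.2⟩
  have hv₀ : (z (t₀ + h)).2 ∈ closedBall (z t₀).2 r := ball_subset_closedBall hzball'.2
  -- By uniqueness, shooting with the velocity of `z` itself retraces `z`; so the image is a
  -- neighbourhood of the position of `z` at `t₀`.
  have hend : α (p, (z (t₀ + h)).2) (-h) = z t₀ := by
    have hsubδ : Ioo (t₀ - δ) (t₀ + δ) ⊆ Ioo (t₀ - δ₁) (t₀ + δ₁) :=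
      Ioo_subset_Ioo (by linarith) (by linarith)
    have := ODE_solution_unique_of_mem_Ioo (v := fun _ z ↦ (z.2, A z)) (s := fun _ ↦ S) (K := K)
      (t₀ := t₀ + h) (a := t₀ - δ) (b := t₀ + δ)
      (f := fun t ↦ α (p, (z (t₀ + h)).2) (t - (t₀ + h))) (g := z)
      (fun _ _ ↦ hK) ⟨by linarith, by linarith⟩
      (fun t ht ↦ ⟨(hshift _ hv₀ t ht).1, (hshift _ hv₀ t ht).2.2⟩)
      (fun t ht ↦ ⟨(hball t (hsubδ ht)).1, (hball t (hsubδ ht)).2.2⟩)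
      (by simp only [sub_self]; rw [(hα _ (hin _ hv₀)).1])
    have h2 := this (show t₀ ∈ Ioo (t₀ - δ) (t₀ + δ) from ⟨by linarith, by linarith⟩)
    simpa using h2
  simp only [hend] at himage
  filter_upwards [himage] with y hy
  obtain ⟨v, hv, rfl⟩ := hy
  refine ⟨fun t ↦ α (p, v) (t - (t₀ + h)), fun t ht ↦ ⟨(hshift v hv t ht).1, (hshift v hv t ht).2.1⟩,
    ?_, ?_⟩
  · simp only [sub_self]
    rw [(hα _ (hin v hv)).1]
  · simp

/-- Solutions of an autonomous equation with smooth right-hand side are smooth. -/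
theorem contDiffOn_of_hasDerivAt {V : Type*} [NormedAddCommGroup V] [NormedSpace ℝ V]
    {f : V → V} {Ω : Set V} (hf : ContDiffOn ℝ ∞ f Ω) {z : ℝ → V} {J : Set ℝ}
    (hJ : IsOpen J) (hz : ∀ t ∈ J, HasDerivAt z (f (z t)) t ∧ z t ∈ Ω) : ContDiffOn ℝ ∞ z J := by
  rw [contDiffOn_infty]
  intro k
  induction k with
  | zero => exact contDiffOn_zero.2 fun t ht ↦ (hz t ht).1.continuousAt.continuousWithinAt
  | succ k ih =>
    push_cast
    rw [contDiffOn_succ_iff_deriv_of_isOpen hJ]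
    refine ⟨fun t ht ↦ (hz t ht).1.differentiableAt.differentiableWithinAt, by simp, ?_⟩
    -- Bootstrap: if `z` is `C^k`, so is its derivative `f ∘ z`.
    refine ((hf.of_le (by exact_mod_cast le_top)).comp ih fun t ht ↦ (hz t ht).2).congr
      fun t ht ↦ ?_
    exact (hz t ht).1.deriv

end ODE

/-! ### The metric and the time orientation in a chart -/

section

variable {n : ℕ} {M : Type*} [TopologicalSpace M]
  [ChartedSpace (EuclideanSpace ℝ (Fin n)) M]
  {e : OpenPartialHomeomorph M (EuclideanSpace ℝ (Fin n))}

theorem mfderiv_symm_eq_sum (p w : EuclideanSpace ℝ (Fin n)) :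
    mfderiv (𝓡 n) (𝓡 n) e.symm p w = ∑ a, w a • coordVector e p a := by
  have hw : w = ∑ a, w a • EuclideanSpace.single a (1 : ℝ) := by
    ext i
    simp [Finset.sum_apply, Pi.single_apply]
  conv_lhs => rw [hw]
  exact (map_sum (mfderiv (𝓡 n) (𝓡 n) e.symm p) _ _).trans
    (Finset.sum_congr rfl fun a _ ↦ map_smul (mfderiv (𝓡 n) (𝓡 n) e.symm p) _ _)

theorem mfderiv_symm_bijective (he : e ∈ IsManifold.maximalAtlas (𝓡 n) ∞ M)
    {p : EuclideanSpace ℝ (Fin n)} (hp : p ∈ e.target) :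
    Function.Bijective (mfderiv (𝓡 n) (𝓡 n) e.symm p) := by
  have hm : e.MDifferentiable (𝓡 n) (𝓡 n) :=
    ⟨(contMDiffOn_of_mem_maximalAtlas he).mdifferentiableOn (by simp),
      (contMDiffOn_symm_of_mem_maximalAtlas he).mdifferentiableOn (by simp)⟩
  exact hm.symm.mfderiv_bijective hp

variable [IsManifold (𝓡 n) ∞ M]

/-! ### Lorentzian linear algebra -/

theorem LorentzMetric.eq_zero_of_forall_form_eq_zero (g : LorentzMetric n M) {x : M}
    {v : TangentSpace (𝓡 n) x} (hv : ∀ w, g.form x v w = 0) : v = 0 := by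
  obtain ⟨b, hb⟩ := g.lorentzian x
  refine b.ext_elem fun i ↦ ?_
  have h := hv (b i)
  rw [← b.sum_repr v] at h
  simp only [map_sum, map_smul, sum_apply, smul_apply, hb,
    smul_eq_mul, mul_ite, mul_zero, Finset.sum_ite_eq', Finset.mem_univ, if_true] at h
  rw [map_zero, Finsupp.zero_apply]
  split_ifs at h <;> simpa using h

/-- There is a hyperplane on which a Lorentz metric is negative semidefinite. -/
theorem LorentzMetric.exists_functional (g : LorentzMetric n M) (x : M) :
    ∃ ℓ : TangentSpace (𝓡 n) x →ₗ[ℝ] ℝ, ∀ v, ℓ v = 0 → g.form x v v ≤ 0 := by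
  obtain ⟨b, hb⟩ := g.lorentzian x
  have hform : ∀ v, g.form x v v
      = ∑ i : Fin n, (if (i : ℕ) = 0 then 1 else -1) * (b.repr v i) ^ 2 := fun v ↦ by
    conv_lhs => rw [← b.sum_repr v]
    simp only [map_sum, map_smul, sum_apply, smul_apply, hb,
      smul_eq_mul, mul_ite, mul_zero, Finset.sum_ite_eq', Finset.mem_univ, if_true]
    refine Finset.sum_congr rfl fun i _ ↦ ?_
    split_ifs <;> ring
  -- This is the coordinate of index `0`, written as a sum so that no proof of `0 < n` is required.
  refine ⟨∑ i : Fin n, (if (i : ℕ) = 0 then (1 : ℝ) else 0) • b.coord i, fun v hv ↦ ?_⟩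
  rw [hform]
  refine Finset.sum_nonpos fun i _ ↦ ?_
  split_ifs with hi
  · rw [LinearMap.sum_apply, Finset.sum_eq_single i] at hv
    · simp only [hi, if_true, one_smul, Module.Basis.coord_apply] at hv
      rw [hv]
      simp
    · intro j _ hj
      have : (j : ℕ) ≠ 0 := fun h ↦ hj (Fin.ext (h.trans hi.symm))
      simp [this]
    · simp
  · nlinarith [sq_nonneg (b.repr v i)]

/-- Otherwise `u` and `z` would span a positive definite plane. That plane meets the kernel of `ℓ`,
where the form is nonpositive, in the vector `ℓ z • u - ℓ u • z`, which is nonzero because `ℓ u ≠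
0`. -/
theorem LorentzMetric.form_nonpos_of_orthogonal (g : LorentzMetric n M) {x : M}
    {u z : TangentSpace (𝓡 n) x} (hu : IsTimelike g u) (hz : g.form x u z = 0) :
    g.form x z z ≤ 0 := by
  unfold IsTimelike at hu
  obtain ⟨ℓ, hℓ⟩ := g.exists_functional x
  by_contra! hpos
  have huℓ : ℓ u ≠ 0 := fun h ↦ (hℓ u h).not_gt hu
  have h := hℓ (ℓ z • u - ℓ u • z) (by simp [mul_comm])
  have hzu : g.form x z u = 0 := by rw [g.symm, hz]
  simp only [map_sub, map_smul, sub_apply, smul_apply,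
    smul_eq_mul, hz, hzu] at h
  have h1 : 0 < ℓ u * ℓ u := mul_self_pos.2 huℓ
  nlinarith [mul_nonneg (mul_self_nonneg (ℓ z)) hu.le, mul_pos h1 hpos]

/-- Two timelike vectors in the same timecone have positive scalar product. -/
theorem LorentzMetric.form_pos_of_mem_timecone (g : LorentzMetric n M) {x : M}
    {u v w : TangentSpace (𝓡 n) x} (hu : IsTimelike g u) (hv : v ∈ timecone g u)
    (hw : w ∈ timecone g u) : 0 < g.form x v w := by
  obtain ⟨hv, huv⟩ := hv
  obtain ⟨hw, huw⟩ := hw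
  unfold IsTimelike at hv hw
  by_contra! hneg
  -- This combination of `v` and `w` is orthogonal to `u`, yet its square would be positive if
  -- `g(v,w) ≤ 0`.
  have h := g.form_nonpos_of_orthogonal hu (z := g.form x u w • v - g.form x u v • w)
    (by simp [mul_comm])
  have hwv : g.form x w v = g.form x v w := g.symm x w v
  simp only [map_sub, map_smul, sub_apply, smul_apply,
    smul_eq_mul, hwv] at h
  have h1 := mul_pos (mul_pos huw huw) hv
  have h2 := mul_pos (mul_pos huv huv) hw
  have h3 := mul_nonneg (mul_pos huv huw).le (neg_nonneg.2 hneg)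
  nlinarith

/-- Any future-pointing `X` defines the same cone as the chosen `u`. With a smooth local field as
`X`, membership becomes two strict inequalities between continuous functions. -/
theorem TimeOrientation.mem_future_iff {g : LorentzMetric n M} (τ : TimeOrientation g) {x : M}
    {X : TangentSpace (𝓡 n) x} (hX : X ∈ τ.future x) (v : TangentSpace (𝓡 n) x) :
    v ∈ τ.future x ↔ 0 < g.form x v v ∧ 0 < g.form x X v := by
  obtain ⟨u, hu, hfut⟩ := τ.isTimecone x
  rw [hfut] at hX ⊢
  refine ⟨fun hv ↦ ⟨hv.1, g.form_pos_of_mem_timecone hu hX hv⟩, fun hv ↦ ⟨hv.1, ?_⟩⟩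
  exact g.form_pos_of_mem_timecone hX.1 ⟨hu, by rw [g.symm]; exact hX.2⟩ ⟨hv.1, hv.2⟩

/-! ### Smoothness of the coordinate expressions -/

/-- The fields are taken along a map `β` so that the result applies to coordinate vectors, which
live over `e.symm`. -/
theorem LorentzMetric.contMDiffWithinAt_form (g : LorentzMetric n M)
    {β : EuclideanSpace ℝ (Fin n) → M} {Y Z : ∀ p, TangentSpace (𝓡 n) (β p)}
    {s : Set (EuclideanSpace ℝ (Fin n))} {p : EuclideanSpace ℝ (Fin n)}
    (hY : ContMDiffWithinAt (𝓡 n) (𝓡 n).tangent ∞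
      (fun q ↦ (⟨β q, Y q⟩ : TangentBundle (𝓡 n) M)) s p)
    (hZ : ContMDiffWithinAt (𝓡 n) (𝓡 n).tangent ∞
      (fun q ↦ (⟨β q, Z q⟩ : TangentBundle (𝓡 n) M)) s p) :
    ContDiffWithinAt ℝ ∞ (fun q ↦ g.form (β q) (Y q) (Z q)) s p := by
  have hβ : ContMDiffWithinAt (𝓡 n) (𝓡 n) ∞ β s p := by
    rw [Bundle.contMDiffWithinAt_totalSpace] at hY
    exact hY.1
  have : ContMDiffWithinAt (𝓡 n) ((𝓡 n).prod 𝓘(ℝ)) ∞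
      (fun q ↦ Bundle.TotalSpace.mk' ℝ (E := Bundle.Trivial M ℝ) (β q)
        (g.form (β q) (Y q) (Z q))) s p := by
    apply ContMDiffWithinAt.clm_bundle_apply₂ (F₁ := EuclideanSpace ℝ (Fin n))
      (F₂ := EuclideanSpace ℝ (Fin n))
    · exact ContMDiffAt.comp_contMDiffWithinAt p g.contMDiff.contMDiffAt hβ
    · exact hY
    · exact hZ
  rw [Bundle.contMDiffWithinAt_totalSpace] at this
  exact contMDiffWithinAt_iff_contDiffWithinAt.1 this.2

theorem contMDiffOn_coordVector (he : e ∈ IsManifold.maximalAtlas (𝓡 n) ∞ M) (a : Fin n) :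
    ContMDiffOn (𝓡 n) (𝓡 n).tangent ∞
      (fun p ↦ (⟨e.symm p, coordVector e p a⟩ : TangentBundle (𝓡 n) M)) e.target := by
  have h := (contMDiffOn_symm_of_mem_maximalAtlas he).contMDiffOn_tangentMapWithin
    (m := ∞) (by simp) e.open_target.uniqueMDiffOn
  have hc : ContMDiff (𝓡 n) (𝓡 n).tangent ∞ (fun p : EuclideanSpace ℝ (Fin n) ↦
      (⟨p, EuclideanSpace.single a (1 : ℝ)⟩ : TangentBundle (𝓡 n) (EuclideanSpace ℝ (Fin n)))) :=
    contMDiff_vectorSpace_iff_contDiff.2 contDiff_const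
  refine (h.comp (hc.contMDiffOn (s := e.target)) fun p hp ↦ hp).congr fun p hp ↦ ?_
  simp only [Function.comp, tangentMapWithin, coordVector]
  rw [mfderivWithin_of_isOpen e.open_target hp]

theorem contDiffOn_metricMatrix (g : LorentzMetric n M)
    (he : e ∈ IsManifold.maximalAtlas (𝓡 n) ∞ M) (a b : Fin n) :
    ContDiffOn ℝ ∞ (fun p ↦ metricMatrix g e p a b) e.target := fun p hp ↦
  g.contMDiffWithinAt_form (contMDiffOn_coordVector he a p hp) (contMDiffOn_coordVector he b p hp)

/-- The differential of `e.symm` is bijective, so it would carry a nonzero kernel vector of the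
matrix to a nonzero vector orthogonal to the whole tangent space. -/
theorem det_metricMatrix_ne_zero (g : LorentzMetric n M)
    (he : e ∈ IsManifold.maximalAtlas (𝓡 n) ∞ M) {p : EuclideanSpace ℝ (Fin n)}
    (hp : p ∈ e.target) : (metricMatrix g e p).det ≠ 0 := by
  intro hdet
  obtain ⟨v, hv0, hv⟩ := Matrix.exists_mulVec_eq_zero_iff.2 hdet
  have hbij := mfderiv_symm_bijective he hp
  set D := mfderiv (𝓡 n) (𝓡 n) e.symm p with hD
  have hcoord : ∀ b, g.form (e.symm p) (coordVector e p b) (D (WithLp.toLp 2 v)) = 0 := fun b ↦ by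
    have h := congrFun hv b
    rw [hD, mfderiv_symm_eq_sum, map_sum]
    simp only [map_smul, smul_eq_mul]
    simpa [Matrix.mulVec, dotProduct, metricMatrix, mul_comm] using h
  have hzero : D (WithLp.toLp 2 v) = 0 := by
    refine g.eq_zero_of_forall_form_eq_zero fun w ↦ ?_
    obtain ⟨w, rfl⟩ := hbij.2 w
    rw [g.symm, hD, mfderiv_symm_eq_sum p w, map_sum, sum_apply]
    refine Finset.sum_eq_zero fun b _ ↦ ?_
    rw [map_smul, smul_apply, hcoord, smul_zero]
  refine hv0 ?_
  have h0 : WithLp.toLp 2 v = (0 : EuclideanSpace ℝ (Fin n)) :=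
    hbij.1 (hzero.trans (map_zero D).symm)
  ext i
  exact congrArg (fun w : EuclideanSpace ℝ (Fin n) ↦ w i) h0

theorem contDiffOn_matrix_det {V ι : Type*} [NormedAddCommGroup V] [NormedSpace ℝ V] [Fintype ι]
    [DecidableEq ι] {A : V → Matrix ι ι ℝ} {s : Set V}
    (hA : ∀ i j, ContDiffOn ℝ ∞ (fun p ↦ A p i j) s) : ContDiffOn ℝ ∞ (fun p ↦ (A p).det) s := by
  simp only [Matrix.det_apply]
  exact ContDiffOn.sum fun σ _ ↦ (contDiffOn_prod fun i _ ↦ hA (σ i) i).const_smul _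

/-- Cramer's rule: the entries of the adjugate are determinants of the matrix with one row replaced
by a constant one. -/
theorem contDiffOn_matrix_inv {V ι : Type*} [NormedAddCommGroup V] [NormedSpace ℝ V] [Fintype ι]
    [DecidableEq ι] {A : V → Matrix ι ι ℝ} {s : Set V}
    (hA : ∀ i j, ContDiffOn ℝ ∞ (fun p ↦ A p i j) s) (hdet : ∀ p ∈ s, (A p).det ≠ 0) (i j : ι) :
    ContDiffOn ℝ ∞ (fun p ↦ (A p)⁻¹ i j) s := by
  simp only [Matrix.inv_def, Ring.inverse_eq_inv', Matrix.smul_apply, smul_eq_mul,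
    Matrix.adjugate_apply]
  refine ((contDiffOn_matrix_det hA).inv hdet).mul (contDiffOn_matrix_det fun k l ↦ ?_)
  by_cases hk : k = j
  · subst hk
    simpa using contDiffOn_const
  · simpa [Matrix.updateRow_ne hk] using hA k l

theorem contDiffOn_partialDeriv {f : EuclideanSpace ℝ (Fin n) → ℝ}
    {s : Set (EuclideanSpace ℝ (Fin n))} (hs : IsOpen s) (hf : ContDiffOn ℝ ∞ f s) (a : Fin n) :
    ContDiffOn ℝ ∞ (partialDeriv a f) s :=
  (hf.fderiv_of_isOpen hs (by simp)).clm_apply contDiffOn_const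

theorem contDiffOn_christoffel (g : LorentzMetric n M)
    (he : e ∈ IsManifold.maximalAtlas (𝓡 n) ∞ M) (c a b : Fin n) :
    ContDiffOn ℝ ∞ (christoffel g e c a b) e.target := by
  have hd : ∀ i j k, ContDiffOn ℝ ∞ (partialDeriv i fun q ↦ metricMatrix g e q j k) e.target :=
    fun i j k ↦ contDiffOn_partialDeriv e.open_target (contDiffOn_metricMatrix g he j k) i
  refine contDiffOn_const.mul (ContDiffOn.sum fun d _ ↦ ContDiffOn.mul ?_ ?_)
  · exact contDiffOn_matrix_inv (contDiffOn_metricMatrix g he)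
      (fun p hp ↦ det_metricMatrix_ne_zero g he hp) c d
  · exact ((hd a b d).add (hd b a d)).sub (hd d a b)

/-- The right-hand side of the geodesic equations, as a function of position and velocity. -/
def geodesicAccel (g : LorentzMetric n M)
    (e : OpenPartialHomeomorph M (EuclideanSpace ℝ (Fin n)))
    (z : EuclideanSpace ℝ (Fin n) × EuclideanSpace ℝ (Fin n)) : EuclideanSpace ℝ (Fin n) :=
  WithLp.toLp 2 fun c ↦ -∑ a : Fin n, ∑ b : Fin n, christoffel g e c a b z.1 * z.2 a * z.2 b

theorem contDiffOn_geodesicAccel (g : LorentzMetric n M)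
    (he : e ∈ IsManifold.maximalAtlas (𝓡 n) ∞ M) :
    ContDiffOn ℝ ∞ (geodesicAccel g e) (e.target ×ˢ univ) := by
  rw [contDiffOn_euclidean]
  intro c
  have hcoord : ∀ a : Fin n, ContDiff ℝ ∞
      (fun z : EuclideanSpace ℝ (Fin n) × EuclideanSpace ℝ (Fin n) ↦ z.2 a) := fun a ↦
    (contDiff_euclidean.1 contDiff_snd) a
  refine (ContDiffOn.sum fun a _ ↦ ContDiffOn.sum fun b _ ↦ ?_).neg
  exact (((contDiffOn_christoffel g he c a b).comp contDiffOn_fst fun z hz ↦ hz.1).mul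
    (hcoord a).contDiffOn).mul (hcoord b).contDiffOn

/-- Near a future-pointing timelike vector all vectors are future-pointing timelike. -/
theorem TimeOrientation.eventually_mfderiv_symm_mem_future {g : LorentzMetric n M}
    (τ : TimeOrientation g) (he : e ∈ IsManifold.maximalAtlas (𝓡 n) ∞ M)
    {z₀ : EuclideanSpace ℝ (Fin n) × EuclideanSpace ℝ (Fin n)} (hz₀ : z₀.1 ∈ e.target)
    (hfut : mfderiv (𝓡 n) (𝓡 n) e.symm z₀.1 z₀.2 ∈ τ.future (e.symm z₀.1)) :
    ∀ᶠ z in 𝓝 z₀, mfderiv (𝓡 n) (𝓡 n) e.symm z.1 z.2 ∈ τ.future (e.symm z.1) := by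
  obtain ⟨U, hU, hxU, X, hX, hXfut⟩ := τ.smooth (e.symm z₀.1)
  have hopen : IsOpen (e.target ∩ e.symm ⁻¹' U) := e.symm.isOpen_inter_preimage hU
  have hXs : ContMDiffOn (𝓡 n) (𝓡 n).tangent ∞
      (fun p ↦ (⟨e.symm p, X (e.symm p)⟩ : TangentBundle (𝓡 n) M)) (e.target ∩ e.symm ⁻¹' U) :=
    hX.comp ((contMDiffOn_symm_of_mem_maximalAtlas he).mono inter_subset_left) fun p hp ↦ hp.2
  have hcoord : ∀ a : Fin n, Continuous
      (fun z : EuclideanSpace ℝ (Fin n) × EuclideanSpace ℝ (Fin n) ↦ z.2 a) := fun a ↦ by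
    fun_prop
  have hmem : z₀.1 ∈ e.target ∩ e.symm ⁻¹' U := ⟨hz₀, hxU⟩
  have hnhds : ∀ᶠ z in 𝓝 z₀, z.1 ∈ e.target ∩ e.symm ⁻¹' U :=
    continuousAt_fst (hopen.mem_nhds hmem)
  have hq : ContinuousAt (fun z : EuclideanSpace ℝ (Fin n) × EuclideanSpace ℝ (Fin n) ↦
      ∑ a, z.2 a * ∑ b, z.2 b * metricMatrix g e z.1 b a) z₀ := by
    refine tendsto_finsetSum _ fun a _ ↦ ((hcoord a).continuousAt).mul
      (tendsto_finsetSum _ fun b _ ↦ ((hcoord b).continuousAt).mul ?_)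
    exact ContinuousAt.comp (f := Prod.fst) ((contDiffOn_metricMatrix g he b a).continuousOn.continuousAt
      (e.open_target.mem_nhds hz₀)) continuousAt_fst
  have hl : ContinuousAt (fun z : EuclideanSpace ℝ (Fin n) × EuclideanSpace ℝ (Fin n) ↦
      ∑ a, z.2 a * g.form (e.symm z.1) (X (e.symm z.1)) (coordVector e z.1 a)) z₀ := by
    refine tendsto_finsetSum _ fun a _ ↦ ((hcoord a).continuousAt).mul ?_
    refine ContinuousAt.comp (f := Prod.fst)
      (g := fun p ↦ g.form (e.symm p) (X (e.symm p)) (coordVector e p a)) ?_ continuousAt_fst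
    exact (g.contMDiffWithinAt_form (hXs _ hmem)
      ((contMDiffOn_coordVector he a).mono inter_subset_left _ hmem)).continuousWithinAt.continuousAt
        (hopen.mem_nhds hmem)
  -- The two sums are the square of the vector and its product with the local field `X`, both
  -- continuous at `z₀`.
  have hiff : ∀ z : EuclideanSpace ℝ (Fin n) × EuclideanSpace ℝ (Fin n),
      z.1 ∈ e.target ∩ e.symm ⁻¹' U →
      (mfderiv (𝓡 n) (𝓡 n) e.symm z.1 z.2 ∈ τ.future (e.symm z.1) ↔
        0 < ∑ a, z.2 a * ∑ b, z.2 b * metricMatrix g e z.1 b a ∧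
        0 < ∑ a, z.2 a * g.form (e.symm z.1) (X (e.symm z.1)) (coordVector e z.1 a)) := by
    intro z hz
    rw [τ.mem_future_iff (hXfut _ hz.2), mfderiv_symm_eq_sum]
    simp [metricMatrix, map_sum]
  obtain ⟨h1, h2⟩ := (hiff z₀ hmem).1 hfut
  filter_upwards [hnhds, hq.eventually (lt_mem_nhds h1), hl.eventually (lt_mem_nhds h2)]
    with z hz hz1 hz2
  exact (hiff z hz).2 ⟨hz1, hz2⟩

end

section

variable {n : ℕ} {M : Type*} [TopologicalSpace M]
  [ChartedSpace (EuclideanSpace ℝ (Fin n)) M]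
  {e : OpenPartialHomeomorph M (EuclideanSpace ℝ (Fin n))}

/-! ### Geodesics as solutions of a second-order equation -/

/-- The equality is stated in the tangent bundle because the two velocities have different types,
over `σ t` and `σ' t`. -/
theorem velocity_congr {σ σ' : ℝ → M} {t : ℝ} (h : σ =ᶠ[𝓝 t] σ') :
    (⟨σ t, velocity n σ t⟩ : TangentBundle (𝓡 n) M) = ⟨σ' t, velocity n σ' t⟩ := by
  refine Bundle.TotalSpace.ext h.eq_of_nhds (heq_of_eq ?_)
  have : mfderiv 𝓘(ℝ, ℝ) (𝓡 n) σ t = mfderiv 𝓘(ℝ, ℝ) (𝓡 n) σ' t := h.mfderiv_eq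
  exact congrArg (fun f : ℝ →L[ℝ] EuclideanSpace ℝ (Fin n) ↦ f 1) this

theorem velocity_symm_comp (he : e ∈ IsManifold.maximalAtlas (𝓡 n) ∞ M)
    {c : ℝ → EuclideanSpace ℝ (Fin n)} {t : ℝ} {c' : EuclideanSpace ℝ (Fin n)}
    (hc : HasDerivAt c c' t) (ht : c t ∈ e.target) :
    velocity n (fun s ↦ e.symm (c s)) t = mfderiv (𝓡 n) (𝓡 n) e.symm (c t) c' := by
  have h1 : MDifferentiableAt (𝓡 n) (𝓡 n) e.symm (c t) :=
    (contMDiffAt_symm_of_mem_maximalAtlas he ht).mdifferentiableAt (by simp)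
  have h2 := h1.hasMFDerivAt.comp t hc.hasFDerivAt.hasMFDerivAt
  have h3 : mfderiv 𝓘(ℝ, ℝ) (𝓡 n) (fun s ↦ e.symm (c s)) t = _ := h2.mfderiv
  unfold velocity
  rw [h3]
  change mfderiv (𝓡 n) (𝓡 n) e.symm (c t) ((1 : ℝ) • c') = _
  rw [one_smul]

variable [IsManifold (𝓡 n) ∞ M] {g : LorentzMetric n M}

/-- The coordinate expression of a geodesic solves the geodesic equations. -/
theorem IsGeodesicOn.eventually_hasDerivAt {σ : ℝ → M} {J : Set ℝ} (hσ : IsGeodesicOn g σ J)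
    (hJ : IsOpen J) {t₀ : ℝ} (ht₀ : t₀ ∈ J) (he : e ∈ IsManifold.maximalAtlas (𝓡 n) ∞ M)
    (hmem : σ t₀ ∈ e.source) (heq : ∀ᶠ t in 𝓝 t₀, GeodesicEqAt g e σ t) :
    ∀ᶠ t in 𝓝 t₀, σ t ∈ e.source ∧
      HasDerivAt (fun s ↦ e (σ s)) (deriv (fun s ↦ e (σ s)) t) t ∧
      HasDerivAt (fun s ↦ (e (σ s), deriv (fun s ↦ e (σ s)) s))
        (deriv (fun s ↦ e (σ s)) t,
          geodesicAccel g e (e (σ t), deriv (fun s ↦ e (σ s)) t)) t := by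
  have hopen : IsOpen (J ∩ σ ⁻¹' e.source) :=
    hσ.contMDiffOn.continuousOn.isOpen_inter_preimage hJ e.open_source
  have hsm : ContDiffOn ℝ ∞ (fun s ↦ e (σ s)) (J ∩ σ ⁻¹' e.source) :=
    contMDiffOn_iff_contDiffOn.1 ((contMDiffOn_of_mem_maximalAtlas he).comp
      (hσ.contMDiffOn.mono inter_subset_left) fun t ht ↦ ht.2)
  have hsm' := (contDiffOn_infty_iff_deriv_of_isOpen hopen).1 hsm
  have hsm'' := (contDiffOn_infty_iff_deriv_of_isOpen hopen).1 hsm'.2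
  filter_upwards [heq, hopen.mem_nhds ⟨ht₀, hmem⟩] with t ht htJ
  have h1 := (hsm'.1.differentiableAt (hopen.mem_nhds htJ)).hasDerivAt
  have h2 := (hsm''.1.differentiableAt (hopen.mem_nhds htJ)).hasDerivAt
  refine ⟨htJ.2, h1, ?_⟩
  have h3 : deriv (deriv fun s ↦ e (σ s)) t
      = geodesicAccel g e (e (σ t), deriv (fun s ↦ e (σ s)) t) := by
    ext c
    exact eq_neg_of_add_eq_zero_left (ht c)
  rw [← h3]
  exact h1.prodMk h2

/-- Solutions of the geodesic equations in a chart are geodesics. -/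
theorem isGeodesicOn_symm_comp (he : e ∈ IsManifold.maximalAtlas (𝓡 n) ∞ M)
    {w : ℝ → EuclideanSpace ℝ (Fin n) × EuclideanSpace ℝ (Fin n)} {J : Set ℝ} (hJ : IsOpen J)
    (hw : ∀ t ∈ J, HasDerivAt w ((w t).2, geodesicAccel g e (w t)) t ∧ (w t).1 ∈ e.target) :
    IsGeodesicOn g (fun t ↦ e.symm (w t).1) J where
  contMDiffOn := by
    have hF : ContDiffOn ℝ ∞ (fun z : EuclideanSpace ℝ (Fin n) × EuclideanSpace ℝ (Fin n) ↦
        (z.2, geodesicAccel g e z)) (e.target ×ˢ univ) :=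
      contDiff_snd.contDiffOn.prodMk (contDiffOn_geodesicAccel g he)
    have hsm := contDiffOn_of_hasDerivAt hF hJ fun t ht ↦ ⟨(hw t ht).1, (hw t ht).2, trivial⟩
    exact (contMDiffOn_symm_of_mem_maximalAtlas he).comp
      (contMDiffOn_iff_contDiffOn.2 (contDiff_fst.comp_contDiffOn hsm)) fun t ht ↦ (hw t ht).2
  geodesicEq t₀ ht₀ := by
    refine ⟨e, he, e.map_target (hw t₀ ht₀).2, ?_⟩
    have hpos : ∀ t ∈ J, (fun s ↦ e (e.symm (w s).1)) =ᶠ[𝓝 t] fun s ↦ (w s).1 := fun t ht ↦ by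
      filter_upwards [hJ.mem_nhds ht] with s hs using e.right_inv (hw s hs).2
    have hvel : ∀ t ∈ J, deriv (fun s ↦ e (e.symm (w s).1)) t = (w t).2 := fun t ht ↦ by
      rw [(hpos t ht).deriv_eq]
      exact (hasDerivAt_fst_comp (hw t ht).1).deriv
    have hacc : ∀ t ∈ J, deriv (deriv fun s ↦ e (e.symm (w s).1)) t = geodesicAccel g e (w t) :=
      fun t ht ↦ by
        have : deriv (fun s ↦ e (e.symm (w s).1)) =ᶠ[𝓝 t] fun s ↦ (w s).2 := by
          filter_upwards [hJ.mem_nhds ht] with s hs using hvel s hs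
        rw [this.deriv_eq]
        exact (hasDerivAt_snd_comp (hw t ht).1).deriv
    filter_upwards [hJ.mem_nhds ht₀] with t ht c
    rw [hacc t ht, hvel t ht, e.right_inv (hw t ht).2]
    exact neg_add_cancel _

/-- If `σ` is a geodesic whose tangent vector at `t₀` is future-pointing timelike, and `h ≠ 0` is
small, then each point near `σ t₀` is joined to `σ (t₀ + h)` by a future-pointing timelike
geodesic. -/
theorem IsGeodesicOn.exists_joining (τ : TimeOrientation g) {σ : ℝ → M} {J : Set ℝ}
    (hσ : IsGeodesicOn g σ J) (hJ : IsOpen J) {t₀ : ℝ} (ht₀ : t₀ ∈ J)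
    (hfut : velocity n σ t₀ ∈ τ.future (σ t₀)) :
    ∃ δ > (0 : ℝ), ∀ h : ℝ, h ≠ 0 → |h| < δ → ∀ᶠ y in 𝓝 (σ t₀), ∃ σ' : ℝ → M,
      IsGeodesicOn g σ' (Ioo (t₀ - δ) (t₀ + δ)) ∧
      (∀ t ∈ Ioo (t₀ - δ) (t₀ + δ), velocity n σ' t ∈ τ.future (σ' t)) ∧
      σ' (t₀ + h) = σ (t₀ + h) ∧ σ' t₀ = y := by
  obtain ⟨e, he, hmem, heq⟩ := hσ.geodesicEq t₀ ht₀
  have hode := hσ.eventually_hasDerivAt hJ ht₀ he hmem heq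
  set c : ℝ → EuclideanSpace ℝ (Fin n) := fun s ↦ e (σ s) with hc
  obtain ⟨-, hc', -⟩ := hode.self_of_nhds
  have hct : c t₀ ∈ e.target := e.map_source hmem
  have hσc : σ =ᶠ[𝓝 t₀] fun s ↦ e.symm (c s) := by
    filter_upwards [hode] with t ht using (e.left_inv ht.1).symm
  have hfut' : mfderiv (𝓡 n) (𝓡 n) e.symm (c t₀)
      (deriv (F := EuclideanSpace ℝ (Fin n)) c t₀) ∈ τ.future (e.symm (c t₀)) := by
    rw [← velocity_symm_comp he hc' hct]
    have h := velocity_congr (n := n) hσc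
    have h2 : (⟨σ t₀, velocity n σ t₀⟩ : TangentBundle (𝓡 n) M) ∈
        {v : TangentBundle (𝓡 n) M | v.2 ∈ τ.future v.1} := hfut
    rw [h] at h2
    exact h2
  have hA : ContDiffAt ℝ 1 (geodesicAccel g e) (c t₀, deriv c t₀) :=
    ((contDiffOn_geodesicAccel g he).contDiffAt
      ((e.open_target.prod isOpen_univ).mem_nhds ⟨hct, trivial⟩)).of_le (by simp)
  -- Solutions confined to this neighbourhood stay in the chart and are future-pointing timelike for
  -- the whole parameter interval.
  have hW : {z : EuclideanSpace ℝ (Fin n) × EuclideanSpace ℝ (Fin n) | z.1 ∈ e.target ∧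
      mfderiv (𝓡 n) (𝓡 n) e.symm z.1 z.2 ∈ τ.future (e.symm z.1)} ∈ 𝓝 (c t₀, deriv c t₀) :=
    Filter.Eventually.and (continuousAt_fst (e.open_target.mem_nhds hct))
      (τ.eventually_mfderiv_symm_mem_future he hct hfut')
  obtain ⟨δ₁, hδ₁, hjoin⟩ := exists_solution_joining (z := fun t ↦ (c t, deriv c t)) hA
    (hode.mono fun t ht ↦ ht.2.2) hW
  obtain ⟨δ₂, hδ₂, hball⟩ := Metric.eventually_nhds_iff.1 hode
  refine ⟨min δ₁ δ₂, lt_min hδ₁ hδ₂, fun h h0 hh ↦ ?_⟩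
  have hy := (e.continuousAt hmem).eventually (hjoin h h0 (hh.trans_le (min_le_left _ _)))
  filter_upwards [hy, e.open_source.mem_nhds hmem] with y hy hys
  obtain ⟨w, hw, hwh, hw0⟩ := hy
  have hsub : Ioo (t₀ - min δ₁ δ₂) (t₀ + min δ₁ δ₂) ⊆ Ioo (t₀ - δ₁) (t₀ + δ₁) :=
    Ioo_subset_Ioo (by linarith [min_le_left δ₁ δ₂]) (by linarith [min_le_left δ₁ δ₂])
  refine ⟨fun t ↦ e.symm (w t).1, isGeodesicOn_symm_comp he isOpen_Ioo
    fun t ht ↦ ⟨(hw t (hsub ht)).1, (hw t (hsub ht)).2.1⟩, fun t ht ↦ ?_, ?_, ?_⟩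
  · rw [velocity_symm_comp he (hasDerivAt_fst_comp (hw t (hsub ht)).1) (hw t (hsub ht)).2.1]
    exact (hw t (hsub ht)).2.2
  · simp only [hwh]
    refine e.left_inv (hball ?_).1
    simpa [Real.dist_eq] using hh.trans_le (min_le_right _ _)
  · simp only [hw0]
    exact e.left_inv hys

end

/-! ### Trips as chains of segments -/

section Chains

/-- Two points are joined by a single path segment with the property `Q`. -/
def JoinedBySegment {X : Type*} (Q : (ℝ → X) → ℝ → ℝ → Prop) (x y : X) : Prop :=
  ∃ (γ : ℝ → X) (s t : ℝ), s < t ∧ Q γ s t ∧ γ s = x ∧ γ t = y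

/-- Shift invariance lets a new segment start at the parameter where the previous path ends, and
`hcongr` lets each piece of the glued path inherit `Q`. Transitivity of both relations then comes
for free. -/
theorem transGen_joinedBySegment_iff {X : Type*} {Q : (ℝ → X) → ℝ → ℝ → Prop}
    (hcongr : ∀ γ γ' s t, EqOn γ' γ (Icc s t) → Q γ s t → Q γ' s t)
    (hshift : ∀ γ s t c, Q γ s t → Q (fun u ↦ γ (u + c)) (s - c) (t - c)) (x y : X) :
    (∃ (γ : ℝ → X) (a b : ℝ), Piecewise (Q γ) a b ∧ γ a = x ∧ γ b = y) ↔
      Relation.TransGen (JoinedBySegment Q) x y := by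
  constructor
  · rintro ⟨γ, a, b, ⟨k, t, hk, rfl, rfl, ht⟩, rfl, rfl⟩
    have hseg : ∀ i < k, JoinedBySegment Q (γ (t i)) (γ (t (i + 1))) := fun i hi ↦
      ⟨γ, t i, t (i + 1), (ht i hi).1, (ht i hi).2, rfl, rfl⟩
    clear ht
    induction k with
    | zero => exact absurd hk (lt_irrefl 0)
    | succ k ih =>
      have hlast := hseg k k.lt_succ_self
      rcases Nat.eq_zero_or_pos k with rfl | hk'
      · exact Relation.TransGen.single hlast
      · exact (ih hk' fun i hi ↦ hseg i (hi.trans k.lt_succ_self)).tail hlast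
  · intro h
    induction h with
    | single h =>
      obtain ⟨γ, s, t, hst, hQ, rfl, rfl⟩ := h
      refine ⟨γ, s, t, ⟨1, fun i ↦ if i = 0 then s else t, one_pos, by simp, by simp, ?_⟩, rfl, rfl⟩
      intro i hi
      obtain rfl : i = 0 := by omega
      simpa using ⟨hst, hQ⟩
    | tail _ h ih =>
      obtain ⟨γ, a, b, ⟨k, t, hk, rfl, rfl, ht⟩, rfl, hγ⟩ := ih
      obtain ⟨γ', s, r, hsr, hQ, hs, rfl⟩ := h
      have hle : ∀ i ≤ k, t i ≤ t k := fun i hi ↦ by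
        induction hi using Nat.decreasingInduction with
        | self => exact le_rfl
        | of_succ j hj ih => exact (ht j hj).1.le.trans ih
      have h0k : t 0 ≤ t k := hle 0 (Nat.zero_le k)
      have hnot : ¬ t k + (r - s) ≤ t k := by linarith
      refine ⟨fun u ↦ if u ≤ t k then γ u else γ' (u + (s - t k)), t 0, t k + (r - s),
        ⟨k + 1, fun i ↦ if i ≤ k then t i else t k + (r - s), k.succ_pos, by simp, by simp, ?_⟩,
        by simp [h0k], ?_⟩
      · intro i hi
        rcases Nat.lt_succ_iff_lt_or_eq.1 hi with hi | rfl
        · have hi' : i + 1 ≤ k := hi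
          simp only [hi.le, hi', if_true]
          refine ⟨(ht i hi).1, hcongr _ _ _ _ (fun u hu ↦ ?_) (ht i hi).2⟩
          simp [hu.2.trans (hle _ hi')]
        · simp only [le_refl, if_true, Nat.not_succ_le_self, if_false]
          refine ⟨by linarith, hcongr (fun u ↦ γ' (u + (s - t i))) _ _ _ (fun u hu ↦ ?_) ?_⟩
          -- At the junction the glued path takes its left branch; both branches agree there.
          · rcases hu.1.eq_or_lt with rfl | hlt
            · simp [hγ, hs]
            · simp [not_le.2 hlt]
          · have := hshift γ' s r (s - t i) hQ
            convert this using 1 <;> ring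
      · simp only [hnot, if_false]
        congr 1
        ring

end Chains

/-! ### Composition of trips and openness of futures and pasts -/

section

variable {n : ℕ} {M : Type*} [TopologicalSpace M]
  [ChartedSpace (EuclideanSpace ℝ (Fin n)) M] [IsManifold (𝓡 n) ∞ M] {g : LorentzMetric n M}

theorem IsGeodesicOn.comp_add {σ : ℝ → M} {J : Set ℝ} (hσ : IsGeodesicOn g σ J) (c : ℝ) :
    IsGeodesicOn g (fun u ↦ σ (u + c)) ((· + c) ⁻¹' J) where
  contMDiffOn := hσ.contMDiffOn.comp
    (contMDiff_iff_contDiff.2 (contDiff_id.add contDiff_const)).contMDiffOn fun _ ht ↦ ht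
  geodesicEq t₀ ht₀ := by
    obtain ⟨e, he, hmem, heq⟩ := hσ.geodesicEq (t₀ + c) ht₀
    refine ⟨e, he, hmem, ?_⟩
    have hcont : Tendsto (· + c) (𝓝 t₀) (𝓝 (t₀ + c)) :=
      (continuous_id.add continuous_const).continuousAt
    have hd : deriv (fun s ↦ e (σ (s + c))) = fun t ↦ deriv (fun s ↦ e (σ s)) (t + c) :=
      funext fun t ↦ deriv_comp_add_const (fun s ↦ e (σ s)) c t
    filter_upwards [hcont.eventually heq] with t ht i
    rw [hd, deriv_comp_add_const (deriv fun s ↦ e (σ s)) c t]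
    exact ht i

theorem velocity_comp_add {M : Type*} [TopologicalSpace M]
    [ChartedSpace (EuclideanSpace ℝ (Fin n)) M] {σ : ℝ → M} (c t : ℝ)
    (hσ : MDifferentiableAt 𝓘(ℝ, ℝ) (𝓡 n) σ (t + c)) :
    velocity n (fun u ↦ σ (u + c)) t = velocity n σ (t + c) := by
  have h1 := hσ.hasMFDerivAt.comp t (((hasDerivAt_id t).add_const c).hasFDerivAt.hasMFDerivAt)
  have h2 : mfderiv 𝓘(ℝ, ℝ) (𝓡 n) (fun u ↦ σ (u + c)) t = _ := h1.mfderiv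
  unfold velocity
  rw [h2]
  change mfderiv 𝓘(ℝ, ℝ) (𝓡 n) σ (t + c) ((1 : ℝ) • (1 : ℝ)) = _
  rw [one_smul]

theorem IsGeodesicOn.velocity_comp_add {σ : ℝ → M} {l r : ℝ} (hσ : IsGeodesicOn g σ (Ioo l r))
    {c t : ℝ} (ht : t + c ∈ Ioo l r) :
    velocity n (fun u ↦ σ (u + c)) t = velocity n σ (t + c) :=
  Spacetime.velocity_comp_add c t
    ((hσ.contMDiffOn.contMDiffAt (isOpen_Ioo.mem_nhds ht)).mdifferentiableAt (by simp))

/-- Translation of the parameter in a geodesic segment with a condition on the tangent vectors. -/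
theorem IsGeodesicOn.exists_shift {P : ∀ x : M, TangentSpace (𝓡 n) x → Prop} {γ : ℝ → M}
    {s t : ℝ} (c : ℝ)
    (h : ∃ (σ : ℝ → M) (l r : ℝ), l < s ∧ t < r ∧ IsGeodesicOn g σ (Ioo l r) ∧
      (∀ u ∈ Icc s t, P (σ u) (velocity n σ u)) ∧ EqOn γ σ (Icc s t)) :
    ∃ (σ : ℝ → M) (l r : ℝ), l < s - c ∧ t - c < r ∧ IsGeodesicOn g σ (Ioo l r) ∧
      (∀ u ∈ Icc (s - c) (t - c), P (σ u) (velocity n σ u)) ∧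
      EqOn (fun u ↦ γ (u + c)) σ (Icc (s - c) (t - c)) := by
  obtain ⟨σ, l, r, hl, hr, hσ, hP, hγ⟩ := h
  have hmem : ∀ u ∈ Icc (s - c) (t - c), u + c ∈ Icc s t := fun u hu ↦
    ⟨by linarith [hu.1], by linarith [hu.2]⟩
  refine ⟨fun u ↦ σ (u + c), l - c, r - c, by linarith, by linarith, ?_, fun u hu ↦ ?_,
    fun u hu ↦ hγ (hmem u hu)⟩
  · simpa using hσ.comp_add c
  · rw [hσ.velocity_comp_add ⟨hl.trans_le (hmem u hu).1, (hmem u hu).2.trans_lt hr⟩]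
    exact hP _ (hmem u hu)

variable (τ : TimeOrientation g)

theorem chronPrecedes_iff_transGen (x y : M) :
    ChronPrecedes τ x y ↔
      Relation.TransGen (JoinedBySegment (IsTimelikeGeodesicSegment τ)) x y :=
  transGen_joinedBySegment_iff
    (fun _ _ _ _ h ⟨σ, l, r, hl, hr, hσ, hv, hγ⟩ ↦ ⟨σ, l, r, hl, hr, hσ, hv, h.trans hγ⟩)
    (fun _ _ _ c h ↦ IsGeodesicOn.exists_shift (P := fun x v ↦ v ∈ τ.future x) c h) x y

theorem causallyPrecedes_iff_transGen (x y : M) :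
    CausallyPrecedes τ x y ↔
      Relation.TransGen (JoinedBySegment (IsCausalGeodesicSegment τ)) x y := by
  refine transGen_joinedBySegment_iff (fun γ γ' s t h hQ ↦ ?_) (fun γ s t c hQ ↦ ?_) x y
  · rcases hQ with ⟨σ, l, r, hl, hr, hσ, hv, hγ⟩ | hconst
    · exact Or.inl ⟨σ, l, r, hl, hr, hσ, hv, h.trans hγ⟩
    · refine Or.inr fun u hu ↦ ?_
      rw [h hu, h (left_mem_Icc.2 (hu.1.trans hu.2))]
      exact hconst u hu
  · rcases hQ with hQ | hconst
    · exact Or.inl (IsGeodesicOn.exists_shift (P := fun x v ↦ IsFutureCausal τ v) c hQ)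
    · refine Or.inr fun u hu ↦ ?_
      simp only [sub_add_cancel]
      exact hconst _ ⟨by linarith [hu.1], by linarith [hu.2]⟩

theorem ChronPrecedes.trans {x y z : M} (h₁ : ChronPrecedes τ x y) (h₂ : ChronPrecedes τ y z) :
    ChronPrecedes τ x z := by
  rw [chronPrecedes_iff_transGen] at *
  exact h₁.trans h₂

theorem CausallyPrecedes.trans {x y z : M} (h₁ : CausallyPrecedes τ x y)
    (h₂ : CausallyPrecedes τ y z) : CausallyPrecedes τ x z := by
  rw [causallyPrecedes_iff_transGen] at *
  exact h₁.trans h₂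

theorem CausallyPrecedes.refl (x : M) : CausallyPrecedes τ x x := by
  rw [causallyPrecedes_iff_transGen]
  exact .single ⟨fun _ ↦ x, 0, 1, one_pos, Or.inr fun _ _ ↦ rfl, rfl, rfl⟩

theorem ChronPrecedes.causallyPrecedes {x y : M} (h : ChronPrecedes τ x y) :
    CausallyPrecedes τ x y := by
  rw [chronPrecedes_iff_transGen] at h
  rw [causallyPrecedes_iff_transGen]
  refine Relation.TransGen.mono ?_ _ _ h
  rintro a b ⟨γ, s, t, hst, ⟨σ, l, r, hl, hr, hσ, hv, hγ⟩, ha, hb⟩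
  exact ⟨γ, s, t, hst, Or.inl ⟨σ, l, r, hl, hr, hσ, fun u hu ↦ Or.inl (hv u hu), hγ⟩, ha, hb⟩

theorem joinedBySegment_of_isGeodesicOn {σ : ℝ → M} {l r s t : ℝ}
    (hσ : IsGeodesicOn g σ (Ioo l r)) (hl : l < s) (hst : s < t) (hr : t < r)
    (hv : ∀ u ∈ Icc s t, velocity n σ u ∈ τ.future (σ u)) :
    JoinedBySegment (IsTimelikeGeodesicSegment τ) (σ s) (σ t) :=
  ⟨σ, s, t, hst, ⟨σ, l, r, hl, hr, hσ, hv, fun _ _ ↦ rfl⟩, rfl, rfl⟩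

/-- A timelike segment ending at `y` can be cut so that its last part can be redirected to each
point near `y`. -/
theorem JoinedBySegment.exists_eventually_right {x y : M}
    (h : JoinedBySegment (IsTimelikeGeodesicSegment τ) x y) :
    ∃ z, JoinedBySegment (IsTimelikeGeodesicSegment τ) x z ∧
      ∀ᶠ y' in 𝓝 y, JoinedBySegment (IsTimelikeGeodesicSegment τ) z y' := by
  obtain ⟨γ, s, t, hst, ⟨σ, l, r, hl, hr, hσ, hv, hγ⟩, rfl, rfl⟩ := h
  rw [hγ (left_mem_Icc.2 hst.le), hγ (right_mem_Icc.2 hst.le)]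
  obtain ⟨δ, hδ, hjoin⟩ := hσ.exists_joining τ isOpen_Ioo ⟨hl.trans hst, hr⟩
    (hv t (right_mem_Icc.2 hst.le))
  -- Here `h < δ` permits the joining, and `h < t - s` keeps the cut point strictly inside the
  -- segment.
  obtain ⟨h, h0, hlt⟩ := exists_between (lt_min hδ (sub_pos.2 hst))
  have h1 := hlt.trans_le (min_le_left _ _)
  have h2 := hlt.trans_le (min_le_right _ _)
  refine ⟨σ (t + -h), joinedBySegment_of_isGeodesicOn τ hσ hl (by linarith) (by linarith)
    fun u hu ↦ hv u ⟨hu.1, by linarith [hu.2]⟩, ?_⟩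
  filter_upwards [hjoin (-h) (by linarith) (by rwa [abs_neg, abs_of_pos h0])] with y hy
  obtain ⟨σ', hσ', hv', hh, rfl⟩ := hy
  rw [← hh]
  exact joinedBySegment_of_isGeodesicOn τ hσ' (by linarith) (by linarith) (by linarith)
    fun u hu ↦ hv' u ⟨by linarith [hu.1], by linarith [hu.2]⟩

/-- A timelike segment starting at `x` can be cut so that its first part can be replaced by one
starting at any point near `x`. -/
theorem JoinedBySegment.exists_eventually_left {x y : M}
    (h : JoinedBySegment (IsTimelikeGeodesicSegment τ) x y) :
    ∃ z, JoinedBySegment (IsTimelikeGeodesicSegment τ) z y ∧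
      ∀ᶠ x' in 𝓝 x, JoinedBySegment (IsTimelikeGeodesicSegment τ) x' z := by
  obtain ⟨γ, s, t, hst, ⟨σ, l, r, hl, hr, hσ, hv, hγ⟩, rfl, rfl⟩ := h
  rw [hγ (left_mem_Icc.2 hst.le), hγ (right_mem_Icc.2 hst.le)]
  obtain ⟨δ, hδ, hjoin⟩ := hσ.exists_joining τ isOpen_Ioo ⟨hl, hst.trans hr⟩
    (hv s (left_mem_Icc.2 hst.le))
  obtain ⟨h, h0, hlt⟩ := exists_between (lt_min hδ (sub_pos.2 hst))
  have h1 := hlt.trans_le (min_le_left _ _)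
  have h2 := hlt.trans_le (min_le_right _ _)
  refine ⟨σ (s + h), joinedBySegment_of_isGeodesicOn τ hσ (by linarith) (by linarith) hr
    fun u hu ↦ hv u ⟨by linarith [hu.1], hu.2⟩, ?_⟩
  filter_upwards [hjoin h h0.ne' (by rwa [abs_of_pos h0])] with y hy
  obtain ⟨σ', hσ', hv', hh, rfl⟩ := hy
  rw [← hh]
  exact joinedBySegment_of_isGeodesicOn τ hσ' (by linarith) (by linarith) (by linarith)
    fun u hu ↦ hv' u ⟨by linarith [hu.1], by linarith [hu.2]⟩

/-- The point `z` serves twice: it gives a neighbourhood of `y` inside `I⁺(x)`, and it is an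
intermediate point `x ≪ z ≪ y`. -/
theorem ChronPrecedes.exists_eventually_right {x y : M} (h : ChronPrecedes τ x y) :
    ∃ z, ChronPrecedes τ x z ∧ ∀ᶠ y' in 𝓝 y, ChronPrecedes τ z y' := by
  simp only [chronPrecedes_iff_transGen] at *
  obtain ⟨w, hxw, hwy⟩ := Relation.TransGen.tail'_iff.1 h
  obtain ⟨z, hwz, hz⟩ := hwy.exists_eventually_right
  exact ⟨z, Relation.TransGen.tail' hxw hwz, hz.mono fun _ hy ↦ .single hy⟩

theorem isOpen_chronFuture (x : M) : IsOpen (chronFuture τ x) :=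
  isOpen_iff_mem_nhds.2 fun _ hy ↦
    let ⟨_, hxz, hz⟩ := ChronPrecedes.exists_eventually_right τ hy
    hz.mono fun _ hy' ↦ hxz.trans τ hy'

/-- Here the first segment of the trip is redirected instead of the last, so no reversal of the time
orientation is needed. -/
theorem isOpen_setOf_chronPrecedes (y : M) : IsOpen {x | ChronPrecedes τ x y} := by
  refine isOpen_iff_mem_nhds.2 fun x hx ↦ ?_
  replace hx := (chronPrecedes_iff_transGen τ x y).1 hx
  obtain ⟨w, hxw, hwy⟩ := Relation.TransGen.head'_iff.1 hx
  obtain ⟨z, hzw, hz⟩ := hxw.exists_eventually_left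
  refine hz.mono fun x' hx' ↦ (chronPrecedes_iff_transGen τ x' y).2 ?_
  exact .head hx' (Relation.TransGen.head' hzw hwy)

end

end Spacetime

end

/-! ### The theorem -/

theorem mainTheorem3 {n : ℕ} (hn : 2 ≤ n) {M : Type*} [TopologicalSpace M] [T2Space M]
    [ConnectedSpace M] [ChartedSpace (EuclideanSpace ℝ (Fin n)) M] [IsManifold (𝓡 n) ∞ M]
    (g : Spacetime.LorentzMetric n M) (τ : Spacetime.TimeOrientation g) (x : M) (S : Set M) :
    IsOpen (Spacetime.chronFuture τ x) ∧
    IsOpen (Spacetime.chronFutureSet τ S) ∧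
    Spacetime.chronFutureSet τ S = Spacetime.chronFutureSet τ (closure S) ∧
    Spacetime.chronFutureSet τ S
      = Spacetime.chronFutureSet τ (Spacetime.chronFutureSet τ S) ∧
    Spacetime.chronFutureSet τ S ⊆ Spacetime.causalFutureSet τ S ∧
    Spacetime.causalFutureSet τ S
      = Spacetime.causalFutureSet τ (Spacetime.causalFutureSet τ S) := by
  have mem_chron : ∀ (T : Set M) (y : M), y ∈ Spacetime.chronFutureSet τ T ↔
      ∃ x ∈ T, Spacetime.ChronPrecedes τ x y := fun T y ↦ by
    simp [Spacetime.chronFutureSet, Spacetime.chronFuture]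
  have mem_causal : ∀ (T : Set M) (y : M), y ∈ Spacetime.causalFutureSet τ T ↔
      ∃ x ∈ T, Spacetime.CausallyPrecedes τ x y := fun T y ↦ by
    simp [Spacetime.causalFutureSet, Spacetime.causalFuture]
  refine ⟨Spacetime.isOpen_chronFuture τ x,
    isOpen_biUnion fun x _ ↦ Spacetime.isOpen_chronFuture τ x, ?_, ?_, fun y hy ↦ ?_, ?_⟩
  · ext y
    rw [mem_chron, mem_chron]
    refine ⟨fun ⟨x, hx, hxy⟩ ↦ ⟨x, subset_closure hx, hxy⟩, fun ⟨x, hx, hxy⟩ ↦ ?_⟩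
    -- The past of `y` is an open set containing a point of `closure S`, so it meets `S`.
    obtain ⟨x', hx'y, hx'⟩ := mem_closure_iff.1 hx _
      (Spacetime.isOpen_setOf_chronPrecedes τ y) hxy
    exact ⟨x', hx', hx'y⟩
  · ext y
    simp only [mem_chron]
    refine ⟨fun ⟨x, hx, hxy⟩ ↦ ?_, fun ⟨z, ⟨x, hx, hxz⟩, hzy⟩ ↦ ⟨x, hx, hxz.trans τ hzy⟩⟩
    obtain ⟨z, hxz, hz⟩ := hxy.exists_eventually_right
    exact ⟨z, ⟨x, hx, hxz⟩, hz.self_of_nhds⟩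
  · rw [mem_causal]
    obtain ⟨x, hx, hxy⟩ := (mem_chron S y).1 hy
    exact ⟨x, hx, hxy.causallyPrecedes τ⟩
  · ext y
    simp only [mem_causal]
    -- Constant pieces make `≺` reflexive, so `y` can be its own intermediate point.
    exact ⟨fun h ↦ ⟨y, h, Spacetime.CausallyPrecedes.refl τ y⟩,
      fun ⟨z, ⟨x, hx, hxz⟩, hzy⟩ ↦ ⟨x, hx, hxz.trans τ hzy⟩⟩
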